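/- Let $n\ge 3$, $\mathbb{R}^n_+=\{x=(x',x_n)\in\mathbb{R}^{n}: x_n>0\}$, and identify $\partial\mathbb{R}^n_+$ with $\mathbb{R}^{n-1}$ (Lebesgue measure $dx'$) through $x'\mapsto(x',0)$. For $\Omega=\mathbb{R}^n_+$ or $\Omega=\partial\mathbb{R}^n_+$ with its Lebesgue measure $|\cdot|$ and a measurable $f:\Omega\to\mathbb{R}$, let $f^*(t)=\inf\{s>0:|\{|f|>s\}|\le t\}$ and $f^{**}(t)=\frac1t\int_0^t f^*(s)\,ds$ for $t>0$. For $1<d<\infty$, $L^{(d,1)}(\Omega)$ is the space of measurable $f$ with $\int_0^\infty t^{1/d}f^*(t)\frac{dt}{t}<\infty$, with norm $\|f\|_{L^{(d,1)}(\Omega)}=\int_0^\infty t^{1/d}f^{**}(t)\frac{dt}{t}$. Let $$G(x,y,t)=(4\pi t)^{-n/2}\Big[e^{-|x-y|^2/(4t)}+e^{-|x-y^*|^2/(4t)}\Big],\qquad y^*=(y',-y_n),\ t>0,$$ and, writing $G(x,y',t)=G(x,(y',0),t)$, $$\mathcal{G}_1(\psi)(x,t)=\int_{\partial\mathbb{R}^n_+}G(x,y',t)\psi(y')\,dy',\qquad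 \mathcal{G}_2(\varphi)(y',t)=\int_{\mathbb{R}^n_+}G(x,y',t)\varphi(x)\,dx .$$ Let $1<d_1<d_2<\infty$. Then there is a constant $C>0$, depending only on $n,d_1,d_2$, such that for all $\psi\in L^{(d_1,1)}(\partial\mathbb{R}^n_+)$ and all $\varphi\in L^{(d_1,1)}(\mathbb{R}^n_+)$ the integrals defining $\mathcal{G}_1(\psi)$ and $\mathcal{G}_2(\varphi)$ converge absolutely for every $t>0$ (at every $x\in\mathbb{R}^n$, respectively every $y'\in\mathbb{R}^{n-1}$), the functions $\mathcal{G}_1(\psi)(\cdot,0,t)$ and $\mathcal{G}_2(\varphi)(\cdot,t)$ on $\partial\mathbb{R}^n_+$ and $\mathcal{G}_1(\psi)(\cdot,t)$ on $\mathbb{R}^n_+$ are measurable for every $t>0$, their $L^{(d_2,1)}$-norms are measurable functions of $t$ with values in $[0,\infty]$, and $$\int_0^\infty t^{\frac{n-1}{2d_1}-\frac{n-1}{2d_2}-\frac12}\,\|\mathcal{G}_1(\psi)(\cdot,0,t)\|_{L^{(d_2,1)}(\partial\mathbb{R}^n_+)}\,dt\le C\,\|\psi\|_{L^{(d_1,1)}(\partial\mathbb{R}^n_+)},$$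 $$\int_0^\infty t^{\frac{n-1}{2d_1}-\frac{n}{2d_2}-\frac12}\,\|\mathcal{G}_1(\psi)(\cdot,t)\|_{L^{(d_2,1)}(\mathbb{R}^n_+)}\,dt\le C\,\|\psi\|_{L^{(d_1,1)}(\partial\mathbb{R}^n_+)},$$ $$\int_0^\infty t^{\frac{n}{2d_1}-\frac{n-1}{2d_2}-1}\,\|\mathcal{G}_2(\varphi)(\cdot,t)\|_{L^{(d_2,1)}(\partial\mathbb{R}^n_+)}\,dt\le C\,\|\varphi\|_{L^{(d_1,1)}(\mathbb{R}^n_+)}.$$ -/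

import Mathlib

open MeasureTheory Set
open scoped ENNReal NNReal

noncomputable section

/-! ### Lorentz spaces `L^{(p,r)}` -/

/-- The distribution function `λ_f(s) = μ {x : |f x| > s}`. -/
def distribFun {α : Type*} [MeasurableSpace α] (f : α → ℝ) (μ : Measure α) (s : ℝ) : ℝ≥0∞ :=
  μ {x | s < |f x|}

/-- The decreasing rearrangement `f*(t) = inf {s > 0 : λ_f(s) ≤ t}`, for `t > 0`
(with `inf ∅ = ∞`). -/
def rearrangement {α : Type*} [MeasurableSpace α] (f : α → ℝ) (μ : Measure α) (t : ℝ) : ℝ≥0∞ :=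
  ⨅ (s : ℝ) (_ : 0 < s ∧ distribFun f μ s ≤ ENNReal.ofReal t), ENNReal.ofReal s

/-- The averaged rearrangement `f**(t) = (1/t) ∫_0^t f*(s) ds`, for `t > 0`. -/
def avgRearrangement {α : Type*} [MeasurableSpace α] (f : α → ℝ) (μ : Measure α) (t : ℝ) : ℝ≥0∞ :=
  (∫⁻ s in Ioo (0 : ℝ) t, rearrangement f μ s) / ENNReal.ofReal t

/-- `[∫_0^∞ (t^{1/p} h(t))^r dt/t]^{1/r}` for `r < ∞`, and `sup_{t>0} t^{1/p} h(t)` for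
`r = ∞`. -/
def lorentzFunctional (p : ℝ) (r : ℝ≥0∞) (h : ℝ → ℝ≥0∞) : ℝ≥0∞ :=
  if r = ∞ then ⨆ (t : ℝ) (_ : 0 < t), ENNReal.ofReal (t ^ (1 / p)) * h t
  else (∫⁻ t in Ioi (0 : ℝ),
    (ENNReal.ofReal (t ^ (1 / p)) * h t) ^ r.toReal / ENNReal.ofReal t) ^ (1 / r.toReal)

/-- The quasi-norm `‖f‖*_{L^{(p,r)}}`, built from `f*`. -/
def lorentzQuasiNorm {α : Type*} [MeasurableSpace α] (f : α → ℝ) (p : ℝ) (r : ℝ≥0∞)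
    (μ : Measure α) : ℝ≥0∞ :=
  lorentzFunctional p r (rearrangement f μ)

/-- The norm `‖f‖_{L^{(p,r)}}`, built from `f**` (used for `p > 1`). -/
def lorentzNorm {α : Type*} [MeasurableSpace α] (f : α → ℝ) (p : ℝ) (r : ℝ≥0∞)
    (μ : Measure α) : ℝ≥0∞ :=
  lorentzFunctional p r (avgRearrangement f μ)

/-- `f ∈ L^{(p,r)}(μ)`. -/
def MemLorentz {α : Type*} [MeasurableSpace α] (f : α → ℝ) (p : ℝ) (r : ℝ≥0∞)
    (μ : Measure α) : Prop :=
  AEMeasurable f μ ∧ lorentzQuasiNorm f p r μ < ∞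

/-! ### The half-space

The space dimension is `n = m + 1`; a point of `ℝⁿ` is `x = (x', x_n)` with `x_n` its last
coordinate, and the boundary of the half-space is identified with `ℝ^{n-1} = ℝ^m`. -/

/-- The open upper half-space of `ℝⁿ`, `n = m + 1`. -/
def upperHalf (m : ℕ) : Set (EuclideanSpace ℝ (Fin (m + 1))) :=
  {x | 0 < x (Fin.last m)}

/-- The boundary point `(y', 0)`. -/
def bdryPoint {m : ℕ} (y : EuclideanSpace ℝ (Fin m)) : EuclideanSpace ℝ (Fin (m + 1)) :=
  WithLp.toLp 2 (Fin.snoc (α := fun _ => ℝ) (fun i => y i) 0)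

/-- The reflection `y* = (y', -y_n)`. -/
def reflectLast {m : ℕ} (y : EuclideanSpace ℝ (Fin (m + 1))) :
    EuclideanSpace ℝ (Fin (m + 1)) :=
  WithLp.toLp 2 (Function.update (fun i => y i) (Fin.last m) (-y (Fin.last m)))

/-- The (Neumann) heat kernel of the half-space,
`G(x,y,t) = (4πt)^{-n/2} [exp(-|x-y|²/(4t)) + exp(-|x-y*|²/(4t))]`, `n = m + 1`. -/
def heatG {m : ℕ} (x y : EuclideanSpace ℝ (Fin (m + 1))) (t : ℝ) : ℝ :=
  (4 * Real.pi * t) ^ (-((m : ℝ) + 1) / 2) *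
    (Real.exp (-‖x - y‖ ^ 2 / (4 * t)) + Real.exp (-‖x - reflectLast y‖ ^ 2 / (4 * t)))

/-- `𝒢₁(ψ)(x,t) = ∫_{∂ℝⁿ₊} G(x,y',t) ψ(y') dy'`. -/
def opG₁ {m : ℕ} (ψ : EuclideanSpace ℝ (Fin m) → ℝ)
    (x : EuclideanSpace ℝ (Fin (m + 1))) (t : ℝ) : ℝ :=
  ∫ y, heatG x (bdryPoint y) t * ψ y

/-- `𝒢₂(φ)(y',t) = ∫_{ℝⁿ₊} G(x,y',t) φ(x) dx`. -/
def opG₂ {m : ℕ} (φ : EuclideanSpace ℝ (Fin (m + 1)) → ℝ)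
    (y : EuclideanSpace ℝ (Fin m)) (t : ℝ) : ℝ :=
  ∫ x in upperHalf m, heatG x (bdryPoint y) t * φ x

end

/-! All three estimates are instances of one for a positive kernel `K t y x` with three decay rates:
row integrals at most `c t^(-b)`, column integrals at most `c t^(-a)`, pointwise size at most `c
t^(-(b+κ))`. Write `λ` for the distribution function of `f`. By the layer-cake formula `|Tf|` is at
most the integral over `s > 0` of `T` applied to the indicator of `{|f| > s}`. Each such image has
sup norm at most `min(A, A' λ(s))` and `L¹` norm at most `B λ(s)`. As `τ f**(τ)` behaves like the
K-functional of `(L¹, L^∞)`, this gives `(Tf)**(τ) ≤ ∫ min(A, A' λ(s), B λ(s)/τ) ds`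
(`avgRearrangement_le_lintegral_levelBound`).

After Tonelli the problem is scalar: for a fixed level measure `l`, the weighted integral in `τ` and
`t` of this minimum is at most `C l^(1/p)` (`lintegral_levelBound_le`). The bound `A` makes the
`t`-integral converge at 0 and `A' l` makes it converge at infinity; the strict inequalities `1 < p
< q` give room on both sides. Finally `∫ λ(s)^(1/p) ds` is controlled by the `L^(p,1)` quasi-norm
(`lintegral_distribFun_rpow_le`), which is where the second index 1 is essential. For the heat
kernel the three rates are Gaussian integrals. -/

/-! ### Layer-cake formula in `ℝ≥0∞`. -/

theorem volume_Ioi_inter_ofReal_lt (x : ℝ≥0∞) :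
    volume (Ioi (0 : ℝ) ∩ {s | ENNReal.ofReal s < x}) = x := by
  rcases eq_or_ne x ∞ with rfl | hx
  · simp
  · have : Ioi (0 : ℝ) ∩ {s | ENNReal.ofReal s < x} = Ioo 0 x.toReal := by
      ext s
      simp only [mem_inter_iff, mem_Ioi, mem_ofPred_eq, mem_Ioo, and_congr_right_iff]
      intro hs
      rw [ENNReal.ofReal_lt_iff_lt_toReal hs.le hx]
    rw [this, Real.volume_Ioo, sub_zero, ENNReal.ofReal_toReal hx]

theorem volume_Ioi_inter_ofReal_le (x : ℝ≥0∞) :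
    volume (Ioi (0 : ℝ) ∩ {s | ENNReal.ofReal s ≤ x}) = x := by
  rcases eq_or_ne x ∞ with rfl | hx
  · simp
  · have : Ioi (0 : ℝ) ∩ {s | ENNReal.ofReal s ≤ x} = Ioc 0 x.toReal := by
      ext s
      simp only [mem_inter_iff, mem_Ioi, mem_ofPred_eq, mem_Ioc, and_congr_right_iff]
      intro hs
      rw [ENNReal.ofReal_le_iff_le_toReal hx]
    rw [this, Real.volume_Ioc, sub_zero, ENNReal.ofReal_toReal hx]

/-- Tonelli for the region under the graph of `g`: both sides are its product measure. -/
theorem lintegral_Ioi_measure_ofReal_lt {α : Type*} [MeasurableSpace α] (μ : Measure α)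
    [SFinite μ] {g : α → ℝ≥0∞} (hg : Measurable g) :
    ∫⁻ s in Ioi (0 : ℝ), μ {x | ENNReal.ofReal s < g x} = ∫⁻ x, g x ∂μ := by
  have hm : MeasurableSet {p : ℝ × α | ENNReal.ofReal p.1 < g p.2} :=
    measurableSet_lt (by fun_prop) (by fun_prop)
  have h1 := Measure.prod_apply (μ := volume.restrict (Ioi (0 : ℝ))) (ν := μ) hm
  have h2 := Measure.prod_apply_symm (μ := volume.restrict (Ioi (0 : ℝ))) (ν := μ) hm
  have h3 := h1.symm.trans h2
  simp only [preimage_ofPred_eq] at h3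
  rw [h3]
  refine lintegral_congr fun x => ?_
  rw [Measure.restrict_apply (measurableSet_lt (by fun_prop) (by fun_prop)), inter_comm]
  exact volume_Ioi_inter_ofReal_lt (g x)

/-! ### Rearrangements and the Lorentz functional. -/

section Rearrangement

variable {α : Type*} [MeasurableSpace α] {μ : Measure α}

theorem antitone_distribFun (f : α → ℝ) : Antitone (distribFun f μ) := fun _ _ hst =>
  measure_mono fun _ hx => lt_of_le_of_lt hst hx

theorem measurable_distribFun (f : α → ℝ) : Measurable (distribFun f μ) :=
  (antitone_distribFun f).measurable

/-- The distribution function is antitone, so the set on the right is an interval starting at 0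
whose length is the infimum defining `f*`. In this form `f*` is open to Tonelli and to measurability
arguments. -/
theorem rearrangement_eq_volume (f : α → ℝ) (u : ℝ) :
    rearrangement f μ u = volume (Ioi (0 : ℝ) ∩ {s | ENNReal.ofReal u < distribFun f μ s}) := by
  apply le_antisymm
  · rw [← volume_Ioi_inter_ofReal_lt (rearrangement f μ u)]
    refine measure_mono fun s hs => ⟨hs.1, ?_⟩
    by_contra h
    have hs' : 0 < s ∧ distribFun f μ s ≤ ENNReal.ofReal u := ⟨hs.1, not_lt.1 h⟩
    have hle : rearrangement f μ u ≤ ENNReal.ofReal s := iInf₂_le s hs'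
    exact absurd hs.2 (not_lt.2 hle)
  · conv_rhs => rw [← volume_Ioi_inter_ofReal_le (rearrangement f μ u)]
    refine measure_mono fun s hs => ⟨hs.1, ?_⟩
    refine le_iInf₂ fun r hr => ENNReal.ofReal_le_ofReal ?_
    by_contra h
    exact absurd (lt_of_lt_of_le hs.2 (antitone_distribFun f (not_le.1 h).le)) (not_lt.2 hr.2)

theorem antitone_rearrangement (f : α → ℝ) : Antitone (rearrangement f μ) := fun u v huv => by
  rw [rearrangement_eq_volume, rearrangement_eq_volume]
  exact measure_mono fun s hs => ⟨hs.1, lt_of_le_of_lt (ENNReal.ofReal_le_ofReal huv) hs.2⟩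

theorem rearrangement_le_avgRearrangement (f : α → ℝ) {t : ℝ} (ht : 0 < t) :
    rearrangement f μ t ≤ avgRearrangement f μ t := by
  rw [avgRearrangement, ENNReal.le_div_iff_mul_le (by simp [ht]) (by simp)]
  calc rearrangement f μ t * ENNReal.ofReal t
      = ∫⁻ _ in Ioo (0 : ℝ) t, rearrangement f μ t := by simp
    _ ≤ _ := setLIntegral_mono' measurableSet_Ioo fun s hs => antitone_rearrangement f hs.2.le

theorem lorentzFunctional_one (p : ℝ) (h : ℝ → ℝ≥0∞) :
    lorentzFunctional p 1 h =
      ∫⁻ t in Ioi (0 : ℝ), ENNReal.ofReal (t ^ (1 / p)) * h t / ENNReal.ofReal t := by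
  simp [lorentzFunctional]

theorem lorentzQuasiNorm_le_lorentzNorm (f : α → ℝ) (p : ℝ) :
    lorentzQuasiNorm f p 1 μ ≤ lorentzNorm f p 1 μ := by
  rw [lorentzQuasiNorm, lorentzNorm, lorentzFunctional_one, lorentzFunctional_one]
  refine setLIntegral_mono' measurableSet_Ioi fun t ht => ?_
  gcongr
  exact rearrangement_le_avgRearrangement f ht

theorem distribFun_congr_ae {f g : α → ℝ} (h : f =ᵐ[μ] g) : distribFun f μ = distribFun g μ := by
  funext s
  refine measure_congr ?_
  filter_upwards [h] with x hx
  exact propext (by change s < |f x| ↔ s < |g x|; rw [hx])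

theorem rearrangement_congr_ae {f g : α → ℝ} (h : f =ᵐ[μ] g) :
    rearrangement f μ = rearrangement g μ := by
  funext u
  simp only [rearrangement, distribFun_congr_ae h]

theorem lorentzNorm_congr_ae {f g : α → ℝ} (h : f =ᵐ[μ] g) (p : ℝ) (r : ℝ≥0∞) :
    lorentzNorm f p r μ = lorentzNorm g p r μ := by
  have : avgRearrangement f μ = avgRearrangement g μ := by
    funext t
    simp only [avgRearrangement, rearrangement_congr_ae h]
  simp only [lorentzNorm, this]

theorem lintegral_Ioo_rpow_sub_one {q : ℝ} (hq : 0 < q) {T : ℝ} (hT : 0 < T) :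
    ∫⁻ t in Ioo (0 : ℝ) T, ENNReal.ofReal (t ^ (q - 1)) = ENNReal.ofReal (T ^ q / q) := by
  have hi : IntervalIntegrable (fun x : ℝ => x ^ (q - 1)) volume 0 T :=
    intervalIntegral.intervalIntegrable_rpow' (by linarith)
  rw [setLIntegral_congr Ioo_ae_eq_Ioc, ← ofReal_integral_eq_lintegral_ofReal
    ((intervalIntegrable_iff_integrableOn_Ioc_of_le hT.le).1 hi),
    ← intervalIntegral.integral_of_le hT.le, integral_rpow (Or.inl (by linarith))]
  · simp [Real.zero_rpow hq.ne']
  · filter_upwards [ae_restrict_mem measurableSet_Ioc] with t ht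
    exact Real.rpow_nonneg ht.1.le _

theorem lintegral_Ioi_rpow_neg {q : ℝ} (hq : 0 < q) {T : ℝ} (hT : 0 < T) :
    ∫⁻ t in Ioi T, ENNReal.ofReal (t ^ (-q - 1)) = ENNReal.ofReal (T ^ (-q) / q) := by
  rw [← ofReal_integral_eq_lintegral_ofReal (integrableOn_Ioi_rpow_of_lt (by linarith) hT),
    integral_Ioi_rpow_of_lt (by linarith) hT]
  · congr 1
    rw [show -q - 1 + 1 = -q by ring, neg_div_neg_eq]
  · filter_upwards [ae_restrict_mem measurableSet_Ioi] with t ht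
    exact Real.rpow_nonneg (hT.trans ht).le _

theorem rpow_le_lintegral_indicator {q : ℝ} (hq : 0 < q) (x : ℝ≥0∞) :
    x ^ q ≤ ENNReal.ofReal q * ∫⁻ t in Ioi (0 : ℝ),
      {t : ℝ | ENNReal.ofReal t < x}.indicator (fun t => ENNReal.ofReal (t ^ (q - 1))) t := by
  have hfin : ∀ T : ℝ, 0 < T → ENNReal.ofReal T ≤ x → ENNReal.ofReal (T ^ q) ≤
      ENNReal.ofReal q * ∫⁻ t in Ioi (0 : ℝ),
      {t : ℝ | ENNReal.ofReal t < x}.indicator (fun t => ENNReal.ofReal (t ^ (q - 1))) t := by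
    intro T hT hTx
    calc ENNReal.ofReal (T ^ q) = ENNReal.ofReal q * ENNReal.ofReal (T ^ q / q) := by
          rw [← ENNReal.ofReal_mul hq.le, mul_div_cancel₀ _ hq.ne']
      _ = ENNReal.ofReal q * ∫⁻ t in Ioo (0 : ℝ) T, ENNReal.ofReal (t ^ (q - 1)) := by
          rw [lintegral_Ioo_rpow_sub_one hq hT]
      _ ≤ _ := by
          refine mul_le_mul_right ?_ _
          calc ∫⁻ t in Ioo (0 : ℝ) T, ENNReal.ofReal (t ^ (q - 1))
              ≤ ∫⁻ t in Ioo (0 : ℝ) T, {t : ℝ | ENNReal.ofReal t < x}.indicator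
                (fun t => ENNReal.ofReal (t ^ (q - 1))) t := by
                refine setLIntegral_mono' measurableSet_Ioo fun t ht => ?_
                rw [indicator_of_mem]
                exact lt_of_lt_of_le ((ENNReal.ofReal_lt_ofReal_iff hT).2 ht.2) hTx
            _ ≤ _ := lintegral_mono_set fun t ht => ht.1
  rcases eq_or_ne x 0 with rfl | h0
  · simp [hq]
  rcases eq_or_ne x ∞ with rfl | hx
  · rw [ENNReal.top_rpow_of_pos hq]
    refine top_le_iff.2 (ENNReal.eq_top_of_forall_nnreal_le fun r => ?_)
    -- This `T` has `T ^ q = r + 1`, so the right side exceeds every finite `r`.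
    have := hfin (((r : ℝ) + 1) ^ (1 / q)) (by positivity) le_top
    rw [← Real.rpow_mul (by positivity), one_div_mul_cancel hq.ne', Real.rpow_one] at this
    refine le_trans ?_ this
    rw [← ENNReal.ofReal_coe_nnreal]
    exact ENNReal.ofReal_le_ofReal (by linarith)
  · have := hfin x.toReal (ENNReal.toReal_pos h0 hx) (by rw [ENNReal.ofReal_toReal hx])
    rwa [← ENNReal.ofReal_rpow_of_pos (ENNReal.toReal_pos h0 hx), ENNReal.ofReal_toReal hx] at this

/-- Write the power as `(1/p) ∫ t^(1/p-1) dt` over `0 < t < λ(s)` and exchange the integrals: the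
`s`-section at height `t` has length `f*(t)`. -/
theorem lintegral_distribFun_rpow_le (f : α → ℝ) {p : ℝ} (hp : 0 < p) :
    ∫⁻ s in Ioi (0 : ℝ), distribFun f μ s ^ (1 / p) ≤
      ENNReal.ofReal (1 / p) * lorentzQuasiNorm f p 1 μ := by
  have hm : MeasurableSet {z : ℝ × ℝ | ENNReal.ofReal z.2 < distribFun f μ z.1} :=
    measurableSet_lt (by fun_prop) ((measurable_distribFun f).comp measurable_fst)
  have hmeas : Measurable (Function.uncurry fun s t : ℝ =>
      {t : ℝ | ENNReal.ofReal t < distribFun f μ s}.indicator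
        (fun t => ENNReal.ofReal (t ^ (1 / p - 1))) t) := by
    have := (show Measurable fun z : ℝ × ℝ => ENNReal.ofReal (z.2 ^ (1 / p - 1)) by
      fun_prop).indicator hm
    exact this
  calc _ ≤ ∫⁻ s in Ioi (0 : ℝ), ENNReal.ofReal (1 / p) * ∫⁻ t in Ioi (0 : ℝ),
        {t : ℝ | ENNReal.ofReal t < distribFun f μ s}.indicator
          (fun t => ENNReal.ofReal (t ^ (1 / p - 1))) t :=
        lintegral_mono fun s => rpow_le_lintegral_indicator (by positivity) _
    _ = ENNReal.ofReal (1 / p) * ∫⁻ s in Ioi (0 : ℝ), ∫⁻ t in Ioi (0 : ℝ),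
        {t : ℝ | ENNReal.ofReal t < distribFun f μ s}.indicator
          (fun t => ENNReal.ofReal (t ^ (1 / p - 1))) t :=
        lintegral_const_mul' _ _ (by simp)
    _ = ENNReal.ofReal (1 / p) * ∫⁻ t in Ioi (0 : ℝ), ∫⁻ s in Ioi (0 : ℝ),
        {t : ℝ | ENNReal.ofReal t < distribFun f μ s}.indicator
          (fun t => ENNReal.ofReal (t ^ (1 / p - 1))) t := by
        rw [lintegral_lintegral_swap hmeas.aemeasurable]
    _ = _ := by
        rw [lorentzQuasiNorm, lorentzFunctional_one]
        congr 1
        refine setLIntegral_congr_fun measurableSet_Ioi fun t ht => ?_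
        have ht' : (0 : ℝ) < t := ht
        have h1 : ∀ s : ℝ, {t : ℝ | ENNReal.ofReal t < distribFun f μ s}.indicator
            (fun t => ENNReal.ofReal (t ^ (1 / p - 1))) t =
            {s : ℝ | ENNReal.ofReal t < distribFun f μ s}.indicator
              (fun _ => ENNReal.ofReal (t ^ (1 / p - 1))) s := fun s => by
          simp only [indicator, mem_ofPred_eq]
        have hms : MeasurableSet {s : ℝ | ENNReal.ofReal t < distribFun f μ s} :=
          measurableSet_lt measurable_const (measurable_distribFun f)
        simp only [h1]
        rw [lintegral_indicator_const hms, Measure.restrict_apply hms, inter_comm,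
          ← rearrangement_eq_volume, Real.rpow_sub_one ht'.ne',
          ENNReal.ofReal_div_of_pos ht', ENNReal.mul_div_right_comm]

/-- The function `f**` is dominated through any splitting `|f| ≤ g + H`. -/
theorem avgRearrangement_le_of_le_add [SFinite μ] {f : α → ℝ} {g : α → ℝ≥0∞} (hg : Measurable g)
    {H : ℝ≥0∞} (hf : ∀ x, ‖f x‖ₑ ≤ g x + H) {t : ℝ} (ht : 0 < t) :
    avgRearrangement f μ t ≤ (∫⁻ x, g x ∂μ) / ENNReal.ofReal t + H := by
  have ht0 : ENNReal.ofReal t ≠ 0 := by simp [ht]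
  rcases eq_or_ne H ∞ with rfl | hH
  · simp
  set D : ℝ → ℝ≥0∞ := fun s => μ {x | ENNReal.ofReal s < g x} with hD
  have hDa : Antitone D := fun s r hsr => measure_mono fun x hx =>
    lt_of_le_of_lt (ENNReal.ofReal_le_ofReal hsr) hx
  have hstar : ∀ u, rearrangement f μ u ≤
      H + volume (Ioi (0 : ℝ) ∩ {s | ENNReal.ofReal u < D s}) := by
    intro u
    rw [rearrangement_eq_volume]
    set V : Set ℝ := Ioi (0 : ℝ) ∩ {s | ENNReal.ofReal u < D s}
    -- Levels up to `H` cost at most length `H`; beyond it `|f| > s` forces `g > s - H`, so the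
    -- remaining levels lie in a translate of `V`.
    calc _ ≤ volume (Ioc 0 H.toReal ∪ (fun s => s + (-H.toReal)) ⁻¹' V) := by
          refine measure_mono fun s hs => ?_
          rcases le_or_gt s H.toReal with h | h
          · exact Or.inl ⟨hs.1, h⟩
          · refine Or.inr ⟨by simpa using h, lt_of_lt_of_le hs.2 (measure_mono fun x hx => ?_)⟩
            have hx' : s < |f x| := hx
            have h1 : ENNReal.ofReal s < g x + H := by
              refine lt_of_lt_of_le ?_ (hf x)
              rw [Real.enorm_eq_ofReal_abs]
              exact (ENNReal.ofReal_lt_ofReal_iff (lt_trans hs.1 hx')).2 hx'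
            have h2 : ENNReal.ofReal s = ENNReal.ofReal (s + -H.toReal) + H := by
              nth_rw 2 [← ENNReal.ofReal_toReal hH]
              rw [← ENNReal.ofReal_add (by linarith) ENNReal.toReal_nonneg]
              congr 1
              ring
            rw [h2] at h1
            exact lt_of_add_lt_add_right h1
      _ ≤ volume (Ioc 0 H.toReal) + volume ((fun s => s + (-H.toReal)) ⁻¹' V) :=
          measure_union_le _ _
      _ = H + volume V := by
          rw [measure_preimage_add_right, Real.volume_Ioc, sub_zero, ENNReal.ofReal_toReal hH]
  have hm : MeasurableSet {z : ℝ × ℝ | ENNReal.ofReal z.1 < D z.2} :=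
    measurableSet_lt (by fun_prop) (hDa.measurable.comp measurable_snd)
  have hsum : ∫⁻ u in Ioi (0 : ℝ), volume (Ioi (0 : ℝ) ∩ {s | ENNReal.ofReal u < D s}) =
      ∫⁻ x, g x ∂μ := by
    rw [← lintegral_Ioi_measure_ofReal_lt μ hg]
    have h1 := Measure.prod_apply (μ := volume.restrict (Ioi (0 : ℝ)))
      (ν := volume.restrict (Ioi (0 : ℝ))) hm
    have h2 := Measure.prod_apply_symm (μ := volume.restrict (Ioi (0 : ℝ)))
      (ν := volume.restrict (Ioi (0 : ℝ))) hm
    have h3 := h1.symm.trans h2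
    simp only [preimage_ofPred_eq] at h3
    calc _ = ∫⁻ u in Ioi (0 : ℝ), volume.restrict (Ioi (0 : ℝ)) {s | ENNReal.ofReal u < D s} := by
          refine lintegral_congr fun u => ?_
          rw [Measure.restrict_apply (measurableSet_lt measurable_const hDa.measurable), inter_comm]
      _ = _ := h3
      _ = _ := by
          refine lintegral_congr fun s => ?_
          rw [Measure.restrict_apply (measurableSet_lt (by fun_prop) measurable_const), inter_comm]
          exact volume_Ioi_inter_ofReal_lt (D s)
  rw [avgRearrangement]
  calc _ ≤ (ENNReal.ofReal t * H + ∫⁻ x, g x ∂μ) / ENNReal.ofReal t := by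
        gcongr
        rw [← hsum]
        calc _ ≤ ∫⁻ u in Ioo (0 : ℝ) t,
              (H + volume (Ioi (0 : ℝ) ∩ {s | ENNReal.ofReal u < D s})) :=
              lintegral_mono fun u => hstar u
          _ = ENNReal.ofReal t * H +
              ∫⁻ u in Ioo (0 : ℝ) t, volume (Ioi (0 : ℝ) ∩ {s | ENNReal.ofReal u < D s}) := by
              rw [lintegral_add_left measurable_const]
              simp [mul_comm]
          _ ≤ _ := by
              exact add_le_add le_rfl (lintegral_mono_set fun u hu => hu.1)
    _ = _ := by
        rw [ENNReal.add_div, mul_comm (ENNReal.ofReal t),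
          ENNReal.mul_div_cancel_right ht0 ENNReal.ofReal_ne_top, add_comm]

/-- The norms of a jointly measurable family depend measurably on the parameter. -/
theorem measurable_lorentzNorm_one [SFinite μ] {F : ℝ → α → ℝ}
    (hF : Measurable (Function.uncurry F)) (p : ℝ) :
    Measurable fun t => lorentzNorm (F t) p 1 μ := by
  have hd : Measurable fun z : ℝ × ℝ => distribFun (F z.1) μ z.2 := by
    have hs : MeasurableSet {w : (ℝ × ℝ) × α | w.1.2 < |F w.1.1 w.2|} :=
      measurableSet_lt (by fun_prop)
        (hF.comp (show Measurable fun w : (ℝ × ℝ) × α => (w.1.1, w.2) by fun_prop)).abs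
    exact measurable_measure_prodMk_left hs
  have hr : Measurable fun z : ℝ × ℝ => rearrangement (F z.1) μ z.2 := by
    have hs : MeasurableSet ({w : (ℝ × ℝ) × ℝ | 0 < w.2} ∩
        {w | ENNReal.ofReal w.1.2 < distribFun (F w.1.1) μ w.2}) :=
      (measurableSet_lt measurable_const (by fun_prop)).inter (measurableSet_lt (by fun_prop)
        (hd.comp (show Measurable fun w : (ℝ × ℝ) × ℝ => (w.1.1, w.2) by fun_prop)))
    have := measurable_measure_prodMk_left (ν := (volume : Measure ℝ)) hs
    refine (congrArg Measurable (funext fun z => ?_)).mp this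
    rw [rearrangement_eq_volume]
    rfl
  have ha : Measurable fun z : ℝ × ℝ => avgRearrangement (F z.1) μ z.2 := by
    have hs : MeasurableSet ({w : (ℝ × ℝ) × ℝ | 0 < w.2} ∩ {w | w.2 < w.1.2}) :=
      (measurableSet_lt measurable_const (by fun_prop)).inter
        (measurableSet_lt (by fun_prop) (by fun_prop))
    have := ((hr.comp (show Measurable fun w : (ℝ × ℝ) × ℝ => (w.1.1, w.2) by
      fun_prop)).indicator hs).lintegral_prod_right' (ν := (volume : Measure ℝ))
    have h2 := this.div (show Measurable fun z : ℝ × ℝ => ENNReal.ofReal z.2 by fun_prop)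
    refine (congrArg Measurable (funext fun z => ?_)).mp h2
    simp only [avgRearrangement, Pi.div_apply]
    rw [← lintegral_indicator measurableSet_Ioo]
    rfl
  simp only [lorentzNorm, lorentzFunctional_one]
  exact (((show Measurable fun z : ℝ × ℝ => ENNReal.ofReal (z.2 ^ (1 / p)) by
    fun_prop).mul ha).div (show Measurable fun z : ℝ × ℝ => ENNReal.ofReal z.2 by
    fun_prop)).lintegral_prod_right' (ν := volume.restrict (Ioi (0 : ℝ)))

end Rearrangement

/-! ### Scalar integrals of minima of powers. -/

theorem lintegral_Ioi_le_of_le_rpow {h : ℝ → ℝ≥0∞} {α β P Q R : ℝ} (hα : 0 < α) (hβ : 0 < β)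
    (hP : 0 ≤ P) (hQ : 0 ≤ Q) (hR : 0 < R)
    (h₁ : ∀ t, 0 < t → h t ≤ ENNReal.ofReal (P * t ^ (α - 1)))
    (h₂ : ∀ t, 0 < t → h t ≤ ENNReal.ofReal (Q * t ^ (-β - 1))) :
    ∫⁻ t in Ioi (0 : ℝ), h t ≤ ENNReal.ofReal (P * (R ^ α / α) + Q * (R ^ (-β) / β)) := by
  have hsplit : Ioi (0 : ℝ) = Ioc 0 R ∪ Ioi R := (Ioc_union_Ioi_eq_Ioi hR.le).symm
  rw [hsplit, ENNReal.ofReal_add (by positivity) (by positivity)]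
  refine (lintegral_union_le _ _ _).trans (add_le_add ?_ ?_)
  · rw [setLIntegral_congr Ioo_ae_eq_Ioc.symm]
    calc _ ≤ ∫⁻ t in Ioo (0 : ℝ) R, ENNReal.ofReal P * ENNReal.ofReal (t ^ (α - 1)) := by
          refine setLIntegral_mono' measurableSet_Ioo fun t ht => ?_
          rw [← ENNReal.ofReal_mul hP]
          exact h₁ t ht.1
      _ = _ := by
          rw [lintegral_const_mul' _ _ ENNReal.ofReal_ne_top, lintegral_Ioo_rpow_sub_one hα hR,
            ← ENNReal.ofReal_mul hP]
  · calc _ ≤ ∫⁻ t in Ioi R, ENNReal.ofReal Q * ENNReal.ofReal (t ^ (-β - 1)) := by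
          refine setLIntegral_mono' measurableSet_Ioi fun t ht => ?_
          rw [← ENNReal.ofReal_mul hQ]
          exact h₂ t (hR.trans ht)
      _ = _ := by
          rw [lintegral_const_mul' _ _ ENNReal.ofReal_ne_top, lintegral_Ioi_rpow_neg hβ hR,
            ← ENNReal.ofReal_mul hQ]

/-- The two bounds cross at `t = N / M`; splitting there makes both pieces multiples of `M^(1-θ)
N^θ`. -/
theorem lintegral_rpow_mul_div_le {h : ℝ → ℝ≥0∞} {θ M N : ℝ} (hθ : 0 < θ) (hθ1 : θ < 1)
    (hM : 0 < M) (hN : 0 < N) (h₁ : ∀ t, 0 < t → h t ≤ ENNReal.ofReal M)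
    (h₂ : ∀ t, 0 < t → h t ≤ ENNReal.ofReal N / ENNReal.ofReal t) :
    ∫⁻ t in Ioi (0 : ℝ), ENNReal.ofReal (t ^ θ) * h t / ENNReal.ofReal t ≤
      ENNReal.ofReal ((1 / θ + 1 / (1 - θ)) * (M ^ (1 - θ) * N ^ θ)) := by
  have h1θ : 0 < 1 - θ := by linarith
  refine (lintegral_Ioi_le_of_le_rpow (α := θ) (β := 1 - θ) (P := M) (Q := N) (R := N / M)
    hθ h1θ hM.le hN.le (by positivity) ?_ ?_).trans_eq ?_
  · intro t ht
    calc _ ≤ ENNReal.ofReal (t ^ θ) * ENNReal.ofReal M / ENNReal.ofReal t := by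
          gcongr
          exact h₁ t ht
      _ = _ := by
          rw [← ENNReal.ofReal_mul (by positivity), ← ENNReal.ofReal_div_of_pos ht,
            Real.rpow_sub_one ht.ne']
          congr 1
          ring
  · intro t ht
    calc _ ≤ ENNReal.ofReal (t ^ θ) * (ENNReal.ofReal N / ENNReal.ofReal t) /
            ENNReal.ofReal t := by
          gcongr
          exact h₂ t ht
      _ = _ := by
          rw [← ENNReal.ofReal_div_of_pos ht, ← ENNReal.ofReal_mul (by positivity),
            ← ENNReal.ofReal_div_of_pos ht, show -(1 - θ) - 1 = θ - 1 - 1 by ring,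
            Real.rpow_sub_one ht.ne', Real.rpow_sub_one ht.ne']
          congr 1
          field_simp
  · congr 1
    have e1 : (N / M) ^ θ * M = M ^ (1 - θ) * N ^ θ := by
      rw [Real.div_rpow hN.le hM.le, Real.rpow_sub hM, Real.rpow_one]
      field_simp
    have e2 : (N / M) ^ (-(1 - θ)) * N = M ^ (1 - θ) * N ^ θ := by
      rw [Real.rpow_neg (by positivity), Real.div_rpow hN.le hM.le, Real.rpow_sub hN,
        Real.rpow_one]
      field_simp
    linear_combination (1 / θ) * e1 + (1 / (1 - θ)) * e2

/-- The level bound `min (A, A' l, B l / τ)`. -/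
noncomputable def levelBound (A A' B : ℝ≥0∞) (τ : ℝ) (l : ℝ≥0∞) : ℝ≥0∞ :=
  min (min A (A' * l)) (B * l / ENNReal.ofReal τ)

/-- The `τ`-integral is of the form `M^(1-θ) N^θ`. Taking `M = A` leaves `t^(α-1) l^θ`, taking `M =
A' l` leaves `t^(-β-1) l`, and balancing the two over `t` yields `l^η`. The weight in `t` is the one
that cancels `a` and `b`. -/
theorem lintegral_levelBound_le {a b κ θ η c : ℝ} (hκ : 0 < κ) (hθ : 0 < θ) (hθη : θ < η)
    (hη : η < 1) (hc : 0 < c) : ∃ C : ℝ, 0 < C ∧ ∀ l : ℝ≥0∞,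
    ∫⁻ t in Ioi (0 : ℝ), ENNReal.ofReal (t ^ (κ * (η - θ) - 1 + a * θ + b * (1 - θ))) *
      ∫⁻ τ in Ioi (0 : ℝ), ENNReal.ofReal (τ ^ θ) *
        levelBound (ENNReal.ofReal (c * t ^ (-b))) (ENNReal.ofReal (c * t ^ (-(b + κ))))
          (ENNReal.ofReal (c * t ^ (-a))) τ l / ENNReal.ofReal τ ≤
      ENNReal.ofReal C * l ^ η := by
  have hθ1 : θ < 1 := hθη.trans hη
  have h1θ : 0 < 1 - θ := by linarith
  have hη0 : 0 < η := hθ.trans hθη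
  set D : ℝ := (1 / θ + 1 / (1 - θ)) * c with hD
  have hD0 : 0 < D := by positivity
  set α := κ * (η - θ) with hα
  have hα0 : 0 < α := mul_pos hκ (by linarith)
  set β := κ * (1 - η) with hβ
  have hβ0 : 0 < β := mul_pos hκ (by linarith)
  refine ⟨D * (1 / α + 1 / β), by positivity, fun l => ?_⟩
  rcases eq_or_ne l 0 with rfl | hl0
  · simp [levelBound]
  rcases eq_or_ne l ∞ with rfl | hl
  · rw [ENNReal.top_rpow_of_pos hη0, ENNReal.mul_top]
    · exact le_top
    · simp only [ne_eq, ENNReal.ofReal_eq_zero, not_le]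
      positivity
  obtain ⟨r, hr, rfl⟩ : ∃ r : ℝ, 0 < r ∧ l = ENNReal.ofReal r :=
    ⟨l.toReal, ENNReal.toReal_pos hl0 hl, (ENNReal.ofReal_toReal hl).symm⟩
  have hB : ∀ t : ℝ, 0 < t → ∀ τ : ℝ, 0 < τ →
      levelBound (ENNReal.ofReal (c * t ^ (-b))) (ENNReal.ofReal (c * t ^ (-(b + κ))))
          (ENNReal.ofReal (c * t ^ (-a))) τ (ENNReal.ofReal r) ≤
        ENNReal.ofReal (c * t ^ (-a) * r) / ENNReal.ofReal τ := fun t ht τ hτ => by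
    rw [ENNReal.ofReal_mul (by positivity : 0 ≤ c * t ^ (-a))]
    exact min_le_right _ _
  -- The cut `R = r^(1/κ)` is the time at which `t^(-b)` and `t^(-(b+κ)) r` agree.
  refine (lintegral_Ioi_le_of_le_rpow (α := α) (β := β) (P := D * r ^ θ) (Q := D * r)
    (R := r ^ (1 / κ)) hα0 hβ0 (by positivity) (by positivity) (by positivity) ?_ ?_).trans_eq ?_
  · intro t ht
    have := lintegral_rpow_mul_div_le hθ hθ1 (M := c * t ^ (-b)) (N := c * t ^ (-a) * r)
      (by positivity) (by positivity) (fun τ _ => (min_le_left _ _).trans (min_le_left _ _))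
      (hB t ht)
    refine (mul_le_mul_right this _).trans_eq ?_
    rw [← ENNReal.ofReal_mul (by positivity)]
    congr 1
    rw [Real.mul_rpow hc.le (by positivity), Real.mul_rpow (by positivity) hr.le,
      Real.mul_rpow hc.le (by positivity), ← Real.rpow_mul ht.le, ← Real.rpow_mul ht.le]
    have e1 : c ^ (1 - θ) * c ^ θ = c := by
      rw [← Real.rpow_add hc]; simp
    have e2 : t ^ (α - 1 + a * θ + b * (1 - θ)) * (t ^ (-b * (1 - θ)) * t ^ (-a * θ)) =
        t ^ (α - 1) := by
      rw [← Real.rpow_add ht, ← Real.rpow_add ht]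
      congr 1
      ring
    calc _ = (1 / θ + 1 / (1 - θ)) * (c ^ (1 - θ) * c ^ θ) * r ^ θ *
          (t ^ (α - 1 + a * θ + b * (1 - θ)) * (t ^ (-b * (1 - θ)) * t ^ (-a * θ))) := by ring
      _ = _ := by rw [e1, e2]
  · intro t ht
    have := lintegral_rpow_mul_div_le hθ hθ1 (M := c * t ^ (-(b + κ)) * r)
      (N := c * t ^ (-a) * r)
      (by positivity) (by positivity) (fun τ _ => (min_le_left _ _).trans
        ((min_le_right _ _).trans_eq (ENNReal.ofReal_mul (by positivity)).symm))
      (hB t ht)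
    refine (mul_le_mul_right this _).trans_eq ?_
    rw [← ENNReal.ofReal_mul (by positivity)]
    congr 1
    rw [Real.mul_rpow (by positivity) hr.le, Real.mul_rpow hc.le (by positivity),
      Real.mul_rpow (by positivity) hr.le,
      Real.mul_rpow hc.le (by positivity), ← Real.rpow_mul ht.le, ← Real.rpow_mul ht.le]
    have e1 : ∀ u : ℝ, 0 < u → u ^ (1 - θ) * u ^ θ = u := fun u hu => by
      rw [← Real.rpow_add hu]; simp
    have e2 : t ^ (α - 1 + a * θ + b * (1 - θ)) * (t ^ (-(b + κ) * (1 - θ)) * t ^ (-a * θ)) =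
        t ^ (-β - 1) := by
      rw [← Real.rpow_add ht, ← Real.rpow_add ht]
      congr 1
      rw [hα, hβ]
      ring
    calc _ = (1 / θ + 1 / (1 - θ)) * (c ^ (1 - θ) * c ^ θ) * (r ^ (1 - θ) * r ^ θ) *
          (t ^ (α - 1 + a * θ + b * (1 - θ)) * (t ^ (-(b + κ) * (1 - θ)) * t ^ (-a * θ))) := by
          ring
      _ = _ := by rw [e1 c hc, e1 r hr, e2]
  · rw [ENNReal.ofReal_rpow_of_pos hr, ← ENNReal.ofReal_mul (by positivity)]
    congr 1
    have e1 : r ^ θ * (r ^ (1 / κ)) ^ α = r ^ η := by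
      rw [← Real.rpow_mul hr.le, ← Real.rpow_add hr]
      congr 1
      rw [hα]
      field_simp
      ring
    have e2 : r * (r ^ (1 / κ)) ^ (-β) = r ^ η := by
      rw [← Real.rpow_mul hr.le]
      nth_rw 1 [← Real.rpow_one r]
      rw [← Real.rpow_add hr]
      congr 1
      rw [hβ]
      field_simp
      ring
    linear_combination (D / α) * e1 + (D / β) * e2

/-! ### Positive integral operators acting on level sets. -/

section Kernel

variable {X Y : Type*} [MeasurableSpace X] [MeasurableSpace Y] {μ : Measure X} {ν : Measure Y}

theorem setLIntegral_le_min {k : X → ℝ≥0∞} {A A' : ℝ≥0∞} (hA' : ∀ x, k x ≤ A')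
    (hA : ∫⁻ x, k x ∂μ ≤ A) (f : X → ℝ) (s : ℝ) :
    ∫⁻ x in {x | s < |f x|}, k x ∂μ ≤ min A (A' * distribFun f μ s) := by
  refine le_min ((setLIntegral_le_lintegral _ _).trans hA) ?_
  calc _ ≤ ∫⁻ _ in {x | s < |f x|}, A' ∂μ := lintegral_mono hA'
    _ = _ := by simp [distribFun]

variable [SFinite μ]

/-- Layer cake for the measure with density `k`. -/
theorem lintegral_mul_enorm_eq {k : X → ℝ≥0∞} (hk : Measurable k) {f : X → ℝ}
    (hf : Measurable f) :
    ∫⁻ x, k x * ‖f x‖ₑ ∂μ =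
      ∫⁻ s in Ioi (0 : ℝ), ∫⁻ x in {x | s < |f x|}, k x ∂μ := by
  have h := lintegral_Ioi_measure_ofReal_lt (μ.withDensity k) hf.enorm
  rw [lintegral_withDensity_eq_lintegral_mul _ hk hf.enorm] at h
  refine h.symm.trans (setLIntegral_congr_fun measurableSet_Ioi fun s hs => ?_)
  have : {x | ENNReal.ofReal s < ‖f x‖ₑ} = {x | s < |f x|} := by
    ext x
    simp only [mem_ofPred_eq, Real.enorm_eq_ofReal_abs]
    rw [ENNReal.ofReal_lt_ofReal_iff_of_nonneg (le_of_lt hs)]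
  change μ.withDensity k {x | ENNReal.ofReal s < ‖f x‖ₑ} = _
  rw [this, withDensity_apply _ (measurableSet_lt measurable_const hf.abs)]

theorem lintegral_mul_enorm_lt_top {k : X → ℝ≥0∞} (hk : Measurable k) {A A' : ℝ}
    (hA0 : 0 ≤ A) (hA'0 : 0 ≤ A')
    (hA' : ∀ x, k x ≤ ENNReal.ofReal A') (hA : ∫⁻ x, k x ∂μ ≤ ENNReal.ofReal A) {f : X → ℝ}
    (hf : Measurable f) {p : ℝ} (hp : 1 < p) (hfp : lorentzQuasiNorm f p 1 μ < ∞) :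
    ∫⁻ x, k x * ‖f x‖ₑ ∂μ < ∞ := by
  have hp0 : 0 < p := by linarith
  have hp1 : 1 / p < 1 := by rw [div_lt_one hp0]; exact hp
  rw [lintegral_mul_enorm_eq hk hf]
  -- Since `0 < 1/p < 1`, `min(1, l) ≤ l^(1/p)`; this reduces finiteness to the integral of
  -- `λ(s)^(1/p)`.
  have hmin : ∀ l : ℝ≥0∞, min (ENNReal.ofReal A) (ENNReal.ofReal A' * l) ≤
      ENNReal.ofReal (A + A') * l ^ (1 / p) := by
    intro l
    rcases le_total l 1 with hl | hl
    · refine (min_le_right _ _).trans ?_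
      gcongr
      · linarith
      · calc l = l ^ (1 : ℝ) := (ENNReal.rpow_one l).symm
          _ ≤ _ := ENNReal.rpow_le_rpow_of_exponent_ge hl hp1.le
    · refine (min_le_left _ _).trans ?_
      calc ENNReal.ofReal A ≤ ENNReal.ofReal (A + A') * 1 := by
            rw [mul_one]; exact ENNReal.ofReal_le_ofReal (by linarith)
        _ ≤ _ := by
            gcongr
            exact ENNReal.one_le_rpow hl (by positivity)
  calc _ ≤ ∫⁻ s in Ioi (0 : ℝ), ENNReal.ofReal (A + A') * distribFun f μ s ^ (1 / p) :=
        lintegral_mono fun s => (setLIntegral_le_min hA' hA f s).trans (hmin _)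
    _ = ENNReal.ofReal (A + A') * ∫⁻ s in Ioi (0 : ℝ), distribFun f μ s ^ (1 / p) :=
        lintegral_const_mul' _ _ ENNReal.ofReal_ne_top
    _ < ∞ := ENNReal.mul_lt_top ENNReal.ofReal_lt_top
        ((lintegral_distribFun_rpow_le f hp0).trans_lt
          (ENNReal.mul_lt_top ENNReal.ofReal_lt_top hfp))

variable [SFinite ν]

/-- Each level is estimated by whichever of its scaled `L¹` bound and its sup bound is smaller. The
levels of the first kind form the integrable part `g` and the others the constant `H` of
`avgRearrangement_le_of_le_add`, so no constant is lost. -/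
theorem avgRearrangement_le_lintegral_levelBound {k : Y → X → ℝ≥0∞}
    (hk : Measurable (Function.uncurry k)) {A A' B : ℝ≥0∞} (hA' : ∀ y x, k y x ≤ A')
    (hA : ∀ y, ∫⁻ x, k y x ∂μ ≤ A) (hB : ∀ x, ∫⁻ y, k y x ∂ν ≤ B) {f : X → ℝ}
    (hf : Measurable f) {F : Y → ℝ} (hF : ∀ y, ‖F y‖ₑ ≤ ∫⁻ x, k y x * ‖f x‖ₑ ∂μ)
    {τ : ℝ} (hτ : 0 < τ) :
    avgRearrangement F ν τ ≤
      ∫⁻ s in Ioi (0 : ℝ), levelBound A A' B τ (distribFun f μ s) := by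
  have hd := measurable_distribFun (μ := μ) f
  set m : ℝ → ℝ≥0∞ := fun s => min A (A' * distribFun f μ s) with hm
  set n : ℝ → ℝ≥0∞ := fun s => B * distribFun f μ s / ENNReal.ofReal τ with hn
  have hmm : Measurable m := measurable_const.min (hd.const_mul _)
  have hnm : Measurable n := (hd.const_mul _).div_const _
  -- `S` collects the levels whose `L¹` bound divided by `τ` is the smaller; it depends on `τ` but
  -- not on `y`.
  set S : Set ℝ := {s | n s ≤ m s} with hS
  have hSm : MeasurableSet S := measurableSet_le hnm hmm
  set κ : Y → ℝ → ℝ≥0∞ := fun y s => ∫⁻ x in {x | s < |f x|}, k y x ∂μ with hκ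
  have hκm : Measurable (Function.uncurry κ) := by
    have hs : MeasurableSet {z : (Y × ℝ) × X | z.1.2 < |f z.2|} :=
      measurableSet_lt (by fun_prop) (hf.comp measurable_snd).abs
    have := ((hk.comp (show Measurable fun z : (Y × ℝ) × X => (z.1.1, z.2) by
      fun_prop)).indicator hs).lintegral_prod_right' (ν := μ)
    refine (congrArg Measurable (funext fun z => ?_)).mp this
    simp only [Function.uncurry, hκ]
    rw [← lintegral_indicator (measurableSet_lt measurable_const hf.abs)]
    rfl
  have hκn : ∀ s, ∫⁻ y, κ y s ∂ν ≤ B * distribFun f μ s := by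
    intro s
    simp only [hκ]
    rw [lintegral_lintegral_swap hk.aemeasurable]
    calc _ ≤ ∫⁻ _ in {x | s < |f x|}, B ∂μ := lintegral_mono hB
      _ = _ := by simp [distribFun]
  have hsplit : ∀ h : ℝ → ℝ≥0∞, ∫⁻ s in Ioi (0 : ℝ), h s =
      (∫⁻ s in Ioi (0 : ℝ) ∩ S, h s) + ∫⁻ s in Ioi (0 : ℝ) \ S, h s := fun h =>
    (lintegral_inter_add_sdiff h (Ioi (0 : ℝ)) hSm).symm
  have hbound : ∀ y, ‖F y‖ₑ ≤
      (∫⁻ s in Ioi (0 : ℝ) ∩ S, κ y s) + ∫⁻ s in Ioi (0 : ℝ) \ S, m s := by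
    intro y
    refine (hF y).trans ?_
    rw [lintegral_mul_enorm_eq (k := k y) (hk.comp measurable_prodMk_left) hf, hsplit]
    exact add_le_add le_rfl
      (lintegral_mono fun s => setLIntegral_le_min (hA' y) (hA y) f s)
  refine (avgRearrangement_le_of_le_add (hκm.lintegral_prod_right') hbound hτ).trans ?_
  rw [hsplit]
  refine add_le_add ?_ ?_
  · have hswap := lintegral_lintegral_swap (μ := ν) (ν := volume.restrict (Ioi (0 : ℝ) ∩ S))
      (f := κ) hκm.aemeasurable
    calc _ = (∫⁻ s in Ioi (0 : ℝ) ∩ S, ∫⁻ y, κ y s ∂ν) / ENNReal.ofReal τ := by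
          rw [← hswap]; rfl
      _ ≤ (∫⁻ s in Ioi (0 : ℝ) ∩ S, B * distribFun f μ s) / ENNReal.ofReal τ := by
          gcongr with s
          exact hκn s
      _ = ∫⁻ s in Ioi (0 : ℝ) ∩ S, n s := by
          simp only [hn, div_eq_mul_inv]
          rw [lintegral_mul_const _ (hd.const_mul _)]
      _ ≤ _ := by
          refine setLIntegral_mono' (measurableSet_Ioi.inter hSm) fun s hs => ?_
          exact le_min hs.2 le_rfl
  · refine setLIntegral_mono' (measurableSet_Ioi.diff hSm) fun s hs => ?_
    exact le_min le_rfl (le_of_lt (not_le.1 hs.2))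

/-- Time-weighted `L^{(p,1)} → L^{(q,1)}` estimate for a family of integral operators whose kernels
have the scaling of a heat kernel. -/
theorem exists_lintegral_lorentzNorm_le {K : ℝ → Y → X → ℝ}
    (hK : Measurable fun z : (ℝ × Y) × X => K z.1.1 z.1.2 z.2)
    {a b κ c p q : ℝ} (hκ : 0 < κ) (hc : 0 < c) (hp : 1 < p) (hpq : p < q)
    (hK0 : ∀ t, 0 < t → ∀ y x, 0 ≤ K t y x)
    (hKsup : ∀ t, 0 < t → ∀ y x, K t y x ≤ c * t ^ (-(b + κ)))
    (hKμ : ∀ t, 0 < t → ∀ y, ∫⁻ x, ENNReal.ofReal (K t y x) ∂μ ≤ ENNReal.ofReal (c * t ^ (-b)))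
    (hKν : ∀ t, 0 < t → ∀ x, ∫⁻ y, ENNReal.ofReal (K t y x) ∂ν ≤
      ENNReal.ofReal (c * t ^ (-a))) :
    ∃ C : ℝ, 0 < C ∧ ∀ f : X → ℝ, MemLorentz f p 1 μ →
      (∀ t, 0 < t → (∀ y, Integrable (fun x => K t y x * f x) μ)) ∧
      (∀ t, Measurable fun y => ∫ x, K t y x * f x ∂μ) ∧
      (Measurable fun t => lorentzNorm (fun y => ∫ x, K t y x * f x ∂μ) q 1 ν) ∧
      ∫⁻ t in Ioi (0 : ℝ),
        ENNReal.ofReal (t ^ (κ * (1 / p - 1 / q) - 1 + a * (1 / q) + b * (1 - 1 / q))) *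
          lorentzNorm (fun y => ∫ x, K t y x * f x ∂μ) q 1 ν ≤
        ENNReal.ofReal C * lorentzNorm f p 1 μ := by
  have hp0 : 0 < p := by linarith
  have hq0 : 0 < q := by linarith
  obtain ⟨C, hC, hCl⟩ := lintegral_levelBound_le (a := a) (b := b) hκ
    (show 0 < 1 / q by positivity) (one_div_lt_one_div_of_lt hp0 hpq)
    (show 1 / p < 1 by rw [div_lt_one hp0]; exact hp) hc
  refine ⟨C * (1 / p), by positivity, fun f₀ hf₀ => ?_⟩
  -- A Borel representative changes neither the integrals nor the norms, and makes the level sets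
  -- measurable.
  obtain ⟨f, hf, hff₀⟩ := hf₀.1
  have hfp : lorentzQuasiNorm f p 1 μ < ∞ := by
    have := hf₀.2
    rwa [lorentzQuasiNorm, rearrangement_congr_ae hff₀] at this
  have hT : ∀ t y, ∫ x, K t y x * f₀ x ∂μ = ∫ x, K t y x * f x ∂μ := fun t y =>
    integral_congr_ae (by filter_upwards [hff₀] with x hx; rw [hx])
  have hKt : ∀ t y, Measurable fun x => K t y x := fun t y =>
    hK.comp (show Measurable fun x : X => ((t, y), x) by fun_prop)
  simp only [hT]
  rw [lorentzNorm_congr_ae hff₀]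
  have hTm : Measurable (Function.uncurry fun t y => ∫ x, K t y x * f x ∂μ) := by
    have : StronglyMeasurable fun z : (ℝ × Y) × X => K z.1.1 z.1.2 z.2 * f z.2 :=
      (hK.mul (hf.comp measurable_snd)).stronglyMeasurable
    exact this.integral_prod_right'.measurable
  refine ⟨fun t ht y => ?_, fun t => hTm.comp measurable_prodMk_left,
    measurable_lorentzNorm_one hTm q, ?_⟩
  · have hi : Integrable (fun x => K t y x * f x) μ := by
      refine ⟨((hKt t y).mul hf).aestronglyMeasurable, ?_⟩
      rw [hasFiniteIntegral_iff_enorm]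
      have := lintegral_mul_enorm_lt_top (μ := μ) (hKt t y).ennreal_ofReal
        (A := c * t ^ (-b)) (A' := c * t ^ (-(b + κ))) (by positivity) (by positivity)
        (fun x => ENNReal.ofReal_le_ofReal (hKsup t ht y x)) (hKμ t ht y) hf hp hfp
      refine lt_of_le_of_lt (lintegral_mono fun x => ?_) this
      rw [enorm_mul, Real.enorm_of_nonneg (hK0 t ht y x)]
    refine hi.congr ?_
    filter_upwards [hff₀] with x hx
    rw [hx]
  · set w := κ * (1 / p - 1 / q) - 1 + a * (1 / q) + b * (1 - 1 / q) with hw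
    set Φ : ℝ → ℝ → ℝ≥0∞ → ℝ≥0∞ := fun t τ l =>
      levelBound (ENNReal.ofReal (c * t ^ (-b))) (ENNReal.ofReal (c * t ^ (-(b + κ))))
        (ENNReal.ofReal (c * t ^ (-a))) τ l with hΦ
    have hd := measurable_distribFun (μ := μ) f
    set Ψ : ℝ → ℝ → ℝ → ℝ≥0∞ := fun t τ s =>
      ENNReal.ofReal (τ ^ (1 / q)) * Φ t τ (distribFun f μ s) / ENNReal.ofReal τ with hΨ
    have hΦm : Measurable fun z : (ℝ × ℝ) × ℝ => Φ z.1.1 z.2 (distribFun f μ z.1.2) := by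
      simp only [hΦ, levelBound]
      have hd' : Measurable fun z : (ℝ × ℝ) × ℝ => distribFun f μ z.1.2 :=
        hd.comp (by fun_prop)
      fun_prop
    have hΨm : Measurable fun z : (ℝ × ℝ) × ℝ => Ψ z.1.1 z.2 z.1.2 := by
      exact ((show Measurable fun z : (ℝ × ℝ) × ℝ => ENNReal.ofReal (z.2 ^ (1 / q)) by
        fun_prop).mul hΦm).div (show Measurable fun z : (ℝ × ℝ) × ℝ => ENNReal.ofReal z.2 by
        fun_prop)
    clear_value Φ Ψ
    have havg : ∀ t, 0 < t → lorentzNorm (fun y => ∫ x, K t y x * f x ∂μ) q 1 ν ≤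
        ∫⁻ s in Ioi (0 : ℝ), ∫⁻ τ in Ioi (0 : ℝ), Ψ t τ s := by
      intro t ht
      have hm1 : Measurable (Function.uncurry fun s τ => Ψ t τ s) :=
        hΨm.comp (show Measurable fun z : ℝ × ℝ => ((t, z.1), z.2) by fun_prop)
      have hswap := lintegral_lintegral_swap (μ := volume.restrict (Ioi (0 : ℝ)))
        (ν := volume.restrict (Ioi (0 : ℝ))) hm1.aemeasurable
      rw [hswap, lorentzNorm, lorentzFunctional_one]
      refine setLIntegral_mono' measurableSet_Ioi fun τ hτ => ?_
      have hm2 : Measurable fun s => Φ t τ (distribFun f μ s) :=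
        hΦm.comp (show Measurable fun s : ℝ => ((t, s), τ) by fun_prop)
      simp only [hΨ, div_eq_mul_inv]
      rw [lintegral_mul_const _ (hm2.const_mul _), lintegral_const_mul _ hm2]
      gcongr
      rw [hΦ]
      refine avgRearrangement_le_lintegral_levelBound
        (k := fun y x => ENNReal.ofReal (K t y x)) ?_ (fun y x =>
          ENNReal.ofReal_le_ofReal (hKsup t ht y x)) (hKμ t ht) (hKν t ht) hf (fun y => ?_) hτ
      · exact (hK.comp (show Measurable fun z : Y × X => ((t, z.1), z.2) by
          fun_prop)).ennreal_ofReal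
      · refine (enorm_integral_le_lintegral_enorm _).trans (lintegral_mono fun x => ?_)
        rw [enorm_mul, Real.enorm_of_nonneg (hK0 t ht y x)]
    have hm3 : Measurable (Function.uncurry fun t s : ℝ =>
        ENNReal.ofReal (t ^ w) * ∫⁻ τ in Ioi (0 : ℝ), Ψ t τ s) :=
      (show Measurable fun z : ℝ × ℝ => ENNReal.ofReal (z.1 ^ w) by fun_prop).mul
        (hΨm.lintegral_prod_right' (ν := volume.restrict (Ioi (0 : ℝ))))
    -- Exchanging `t` and `s` freezes the level, so the scalar estimate applies with `l = λ(s)`.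
    calc _ ≤ ∫⁻ t in Ioi (0 : ℝ), ∫⁻ s in Ioi (0 : ℝ),
          ENNReal.ofReal (t ^ w) * ∫⁻ τ in Ioi (0 : ℝ), Ψ t τ s := by
          refine setLIntegral_mono' measurableSet_Ioi fun t ht => ?_
          rw [lintegral_const_mul' _ _ ENNReal.ofReal_ne_top]
          exact mul_le_mul_right (havg t ht) _
      _ = ∫⁻ s in Ioi (0 : ℝ), ∫⁻ t in Ioi (0 : ℝ),
          ENNReal.ofReal (t ^ w) * ∫⁻ τ in Ioi (0 : ℝ), Ψ t τ s :=
          lintegral_lintegral_swap hm3.aemeasurable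
      _ ≤ ∫⁻ s in Ioi (0 : ℝ), ENNReal.ofReal C * distribFun f μ s ^ (1 / p) :=
          lintegral_mono fun s => by
            simp only [hΨ, hΦ]
            exact hCl _
      _ = ENNReal.ofReal C * ∫⁻ s in Ioi (0 : ℝ), distribFun f μ s ^ (1 / p) :=
          lintegral_const_mul' _ _ ENNReal.ofReal_ne_top
      _ ≤ ENNReal.ofReal C * (ENNReal.ofReal (1 / p) * lorentzQuasiNorm f p 1 μ) := by
          gcongr
          exact lintegral_distribFun_rpow_le f hp0
      _ ≤ ENNReal.ofReal C * (ENNReal.ofReal (1 / p) * lorentzNorm f p 1 μ) := by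
          gcongr
          exact lorentzQuasiNorm_le_lorentzNorm f p
      _ = _ := by rw [← mul_assoc, ← ENNReal.ofReal_mul hC.le]

end Kernel

/-! ### The heat kernel with one argument on the boundary. -/

theorem reflectLast_bdryPoint {m : ℕ} (y : EuclideanSpace ℝ (Fin m)) :
    reflectLast (bdryPoint y) = bdryPoint y := by
  ext i
  refine Fin.lastCases ?_ (fun i => ?_) i
  · simp [reflectLast, bdryPoint]
  · simp [reflectLast, bdryPoint, (Fin.castSucc_lt_last i).ne]

theorem heatG_bdryPoint {m : ℕ} (x : EuclideanSpace ℝ (Fin (m + 1))) (y : EuclideanSpace ℝ (Fin m))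
    (t : ℝ) : heatG x (bdryPoint y) t =
      2 * (4 * Real.pi * t) ^ (-((m : ℝ) + 1) / 2) *
        Real.exp (-‖x - bdryPoint y‖ ^ 2 / (4 * t)) := by
  rw [heatG, reflectLast_bdryPoint]
  ring

theorem norm_sub_bdryPoint_sq {m : ℕ} (x : EuclideanSpace ℝ (Fin (m + 1)))
    (y : EuclideanSpace ℝ (Fin m)) :
    ‖x - bdryPoint y‖ ^ 2 =
      ‖WithLp.toLp 2 (fun i : Fin m => x i.castSucc) - y‖ ^ 2 + x (Fin.last m) ^ 2 := by
  simp [EuclideanSpace.real_norm_sq_eq, Fin.sum_univ_castSucc, bdryPoint]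

theorem bdryPoint_sub_bdryPoint_norm {m : ℕ} (x y : EuclideanSpace ℝ (Fin m)) :
    ‖bdryPoint x - bdryPoint y‖ = ‖x - y‖ := by
  rw [← sq_eq_sq₀ (norm_nonneg _) (norm_nonneg _), norm_sub_bdryPoint_sq]
  simp [bdryPoint, EuclideanSpace.real_norm_sq_eq]

theorem measurable_bdryPoint {m : ℕ} : Measurable (bdryPoint (m := m)) := by
  refine (WithLp.measurable_toLp 2 _).comp (measurable_pi_lambda _ fun i => ?_)
  refine Fin.lastCases ?_ (fun i => ?_) i
  · simp
  · simp only [Fin.snoc_castSucc]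
    fun_prop

theorem measurable_heatG_bdryPoint {m : ℕ} : Measurable
    fun z : (ℝ × EuclideanSpace ℝ (Fin (m + 1))) × EuclideanSpace ℝ (Fin m) =>
      heatG z.1.2 (bdryPoint z.2) z.1.1 := by
  simp only [heatG_bdryPoint]
  have := measurable_bdryPoint (m := m)
  fun_prop

theorem lintegral_exp_neg_norm_sub_sq {n : ℕ} (w : EuclideanSpace ℝ (Fin n)) {t : ℝ}
    (ht : 0 < t) :
    ∫⁻ v, ENNReal.ofReal (Real.exp (-‖w - v‖ ^ 2 / (4 * t))) =
      ENNReal.ofReal ((4 * Real.pi * t) ^ ((n : ℝ) / 2)) := by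
  rw [lintegral_sub_left_eq_self
    (fun v : EuclideanSpace ℝ (Fin n) => ENNReal.ofReal (Real.exp (-‖v‖ ^ 2 / (4 * t)))) w]
  have hb : 0 < 1 / (4 * t) := by positivity
  have he : ∀ v : EuclideanSpace ℝ (Fin n),
      Real.exp (-‖v‖ ^ 2 / (4 * t)) = Real.exp (-(1 / (4 * t)) * ‖v‖ ^ 2) := fun v => by
    congr 1
    ring
  have hI := GaussianFourier.integral_rexp_neg_mul_sq_norm (V := EuclideanSpace ℝ (Fin n)) hb
  simp only [he]
  rw [← ofReal_integral_eq_lintegral_ofReal _ (ae_of_all _ fun v => (Real.exp_pos _).le), hI]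
  · rw [finrank_euclideanSpace_fin]
    congr 2
    field_simp
  -- A non-integrable function has Bochner integral 0, which the positive Gaussian value excludes.
  · refine not_not.1 fun h => ?_
    rw [integral_undef h] at hI
    exact absurd hI (by positivity)

section Bounds

variable {m : ℕ} {t : ℝ}

theorem heatG_bdryPoint_nonneg (ht : 0 < t) (x : EuclideanSpace ℝ (Fin (m + 1)))
    (y : EuclideanSpace ℝ (Fin m)) : 0 ≤ heatG x (bdryPoint y) t := by
  rw [heatG_bdryPoint]
  positivity

theorem four_pi_mul_rpow_neg_le (ht : 0 < t) {r : ℝ} (hr : 0 ≤ r) :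
    (4 * Real.pi * t) ^ (-r) ≤ t ^ (-r) := by
  refine Real.rpow_le_rpow_of_nonpos ht ?_ (by linarith)
  nlinarith [Real.pi_gt_three]

theorem heatG_bdryPoint_le (ht : 0 < t) (x : EuclideanSpace ℝ (Fin (m + 1)))
    (y : EuclideanSpace ℝ (Fin m)) :
    heatG x (bdryPoint y) t ≤ 2 * t ^ (-(((m : ℝ) + 1) / 2)) := by
  rw [heatG_bdryPoint, neg_div]
  have h1 : Real.exp (-‖x - bdryPoint y‖ ^ 2 / (4 * t)) ≤ 1 := by
    rw [Real.exp_le_one_iff, neg_div]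
    exact neg_nonpos.2 (by positivity)
  have h2 := four_pi_mul_rpow_neg_le ht (r := ((m : ℝ) + 1) / 2) (by positivity)
  calc _ ≤ 2 * (4 * Real.pi * t) ^ (-(((m : ℝ) + 1) / 2)) * 1 := by gcongr
    _ ≤ _ := by linarith

/-- Over all of `ℝⁿ` the kernel is twice a Gaussian of mass one. The exponent `-0` puts the bound in
the form `c t^(-a)` or `c t^(-b)`. -/
theorem lintegral_heatG_bdryPoint_left_le (ht : 0 < t) (y : EuclideanSpace ℝ (Fin m))
    (s : Set (EuclideanSpace ℝ (Fin (m + 1)))) :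
    ∫⁻ x in s, ENNReal.ofReal (heatG x (bdryPoint y) t) ≤ ENNReal.ofReal (2 * t ^ (-(0 : ℝ))) := by
  refine (setLIntegral_le_lintegral _ _).trans ?_
  simp only [heatG_bdryPoint, norm_sub_rev _ (bdryPoint y)]
  simp_rw [ENNReal.ofReal_mul (show 0 ≤ 2 * (4 * Real.pi * t) ^ (-((m : ℝ) + 1) / 2) by positivity)]
  rw [lintegral_const_mul' _ _ ENNReal.ofReal_ne_top, lintegral_exp_neg_norm_sub_sq _ ht,
    ← ENNReal.ofReal_mul (by positivity), mul_assoc, ← Real.rpow_add (by positivity)]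
  refine ENNReal.ofReal_le_ofReal (le_of_eq ?_)
  congr 1
  rw [show -((m : ℝ) + 1) / 2 + ((m + 1 : ℕ) : ℝ) / 2 = 0 by push_cast; ring]
  simp

/-- Discarding the factor from `x_n` leaves an `m`-dimensional Gaussian of mass `(4πt)^(m/2)`
against the normalisation for dimension `m + 1`; the missing dimension costs `t^(-1/2)`. -/
theorem lintegral_heatG_bdryPoint_right_le (ht : 0 < t) (x : EuclideanSpace ℝ (Fin (m + 1))) :
    ∫⁻ y, ENNReal.ofReal (heatG x (bdryPoint y) t) ≤
      ENNReal.ofReal (2 * t ^ (-(1 / 2 : ℝ))) := by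
  set x' : EuclideanSpace ℝ (Fin m) := WithLp.toLp 2 (fun i : Fin m => x i.castSucc)
  calc _ ≤ ∫⁻ y, ENNReal.ofReal (2 * (4 * Real.pi * t) ^ (-((m : ℝ) + 1) / 2)) *
        ENNReal.ofReal (Real.exp (-‖x' - y‖ ^ 2 / (4 * t))) := by
        refine lintegral_mono fun y => ?_
        rw [← ENNReal.ofReal_mul (by positivity), heatG_bdryPoint, norm_sub_bdryPoint_sq]
        gcongr
        simp only [x']
        linarith [sq_nonneg (x (Fin.last m))]
    _ = ENNReal.ofReal (2 * (4 * Real.pi * t) ^ (-(1 / 2 : ℝ))) := by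
        rw [lintegral_const_mul' _ _ ENNReal.ofReal_ne_top, lintegral_exp_neg_norm_sub_sq _ ht,
          ← ENNReal.ofReal_mul (by positivity), mul_assoc, ← Real.rpow_add (by positivity)]
        congr 3
        ring
    _ ≤ _ := by
        have := four_pi_mul_rpow_neg_le ht (r := 1 / 2) (by norm_num)
        gcongr

end Bounds

/-! ### The three estimates. -/

theorem mainTheorem4 (m : ℕ) (hm : 3 ≤ m + 1) (d₁ d₂ : ℝ) (hd₁ : 1 < d₁) (hd₁₂ : d₁ < d₂) :
    ∃ C : ℝ, 0 < C ∧
      -- the operator `𝒢₁`, on the boundary and in the half-space (the dimension is `n = m + 1`)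
      (∀ ψ : EuclideanSpace ℝ (Fin m) → ℝ, MemLorentz ψ d₁ 1 volume →
        (∀ t : ℝ, 0 < t →
          (∀ x : EuclideanSpace ℝ (Fin (m + 1)),
            Integrable (fun y => heatG x (bdryPoint y) t * ψ y) volume) ∧
          AEMeasurable (fun x' : EuclideanSpace ℝ (Fin m) => opG₁ ψ (bdryPoint x') t) volume ∧
          AEMeasurable (fun x => opG₁ ψ x t) (volume.restrict (upperHalf m))) ∧
        AEMeasurable (fun t : ℝ => lorentzNorm
          (fun x' : EuclideanSpace ℝ (Fin m) => opG₁ ψ (bdryPoint x') t) d₂ 1 volume)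
          (volume.restrict (Ioi 0)) ∧
        ∫⁻ t in Ioi (0 : ℝ),
            ENNReal.ofReal (t ^ ((((m + 1 : ℕ) : ℝ) - 1) / (2 * d₁)
              - (((m + 1 : ℕ) : ℝ) - 1) / (2 * d₂) - 1 / 2)) *
            lorentzNorm (fun x' : EuclideanSpace ℝ (Fin m) => opG₁ ψ (bdryPoint x') t)
              d₂ 1 volume
          ≤ ENNReal.ofReal C * lorentzNorm ψ d₁ 1 volume ∧
        AEMeasurable (fun t : ℝ => lorentzNorm
          (fun x => opG₁ ψ x t) d₂ 1 (volume.restrict (upperHalf m)))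
          (volume.restrict (Ioi 0)) ∧
        ∫⁻ t in Ioi (0 : ℝ),
            ENNReal.ofReal (t ^ ((((m + 1 : ℕ) : ℝ) - 1) / (2 * d₁)
              - ((m + 1 : ℕ) : ℝ) / (2 * d₂) - 1 / 2)) *
            lorentzNorm (fun x => opG₁ ψ x t) d₂ 1 (volume.restrict (upperHalf m))
          ≤ ENNReal.ofReal C * lorentzNorm ψ d₁ 1 volume) ∧
      -- the operator `𝒢₂`
      (∀ φ : EuclideanSpace ℝ (Fin (m + 1)) → ℝ,
        MemLorentz φ d₁ 1 (volume.restrict (upperHalf m)) →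
        (∀ t : ℝ, 0 < t →
          (∀ y : EuclideanSpace ℝ (Fin m),
            Integrable (fun x => heatG x (bdryPoint y) t * φ x)
              (volume.restrict (upperHalf m))) ∧
          AEMeasurable (fun y => opG₂ φ y t) volume) ∧
        AEMeasurable (fun t : ℝ => lorentzNorm (fun y => opG₂ φ y t) d₂ 1 volume)
          (volume.restrict (Ioi 0)) ∧
        ∫⁻ t in Ioi (0 : ℝ),
            ENNReal.ofReal (t ^ (((m + 1 : ℕ) : ℝ) / (2 * d₁)
              - (((m + 1 : ℕ) : ℝ) - 1) / (2 * d₂) - 1)) *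
            lorentzNorm (fun y => opG₂ φ y t) d₂ 1 volume
          ≤ ENNReal.ofReal C * lorentzNorm φ d₁ 1 (volume.restrict (upperHalf m))) := by
  have hm0 : (0 : ℝ) < m := by
    have : 0 < m := by omega
    exact_mod_cast this
  -- In all three applications a boundary integral contributes rate `1/2`, an interior integral rate
  -- `0`, and `κ` is fixed by `b + κ = (m + 1) / 2`, the decay of the sup of the kernel.
  obtain ⟨C₁, hC₁, H₁⟩ := exists_lintegral_lorentzNorm_le
    (μ := (volume : Measure (EuclideanSpace ℝ (Fin m))))
    (ν := (volume : Measure (EuclideanSpace ℝ (Fin m))))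
    (K := fun t x' y => heatG (bdryPoint x') (bdryPoint y) t)
    (a := 1 / 2) (b := 1 / 2) (κ := (m : ℝ) / 2) (c := 2)
    (measurable_heatG_bdryPoint.comp
      (show Measurable fun z : (ℝ × EuclideanSpace ℝ (Fin m)) × EuclideanSpace ℝ (Fin m) =>
        ((z.1.1, bdryPoint z.1.2), z.2) by
        have := measurable_bdryPoint (m := m)
        fun_prop))
    (by positivity) two_pos hd₁ hd₁₂
    (fun t ht x' y => heatG_bdryPoint_nonneg ht _ y)
    (fun t ht x' y => (heatG_bdryPoint_le ht _ y).trans_eq (by congr 3; ring))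
    (fun t ht x' => lintegral_heatG_bdryPoint_right_le ht _)
    -- Between boundary points the kernel is symmetric, so the column bound is the row bound.
    (fun t ht y => by
      refine le_of_eq_of_le (lintegral_congr fun x' => ?_)
        (lintegral_heatG_bdryPoint_right_le ht (bdryPoint y))
      simp only [heatG_bdryPoint, bdryPoint_sub_bdryPoint_norm, norm_sub_rev x' y])
  obtain ⟨C₂, hC₂, H₂⟩ := exists_lintegral_lorentzNorm_le
    (μ := (volume : Measure (EuclideanSpace ℝ (Fin m))))
    (ν := (volume : Measure (EuclideanSpace ℝ (Fin (m + 1)))).restrict (upperHalf m))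
    (K := fun t x y => heatG x (bdryPoint y) t)
    (a := 0) (b := 1 / 2) (κ := (m : ℝ) / 2) (c := 2)
    measurable_heatG_bdryPoint (by positivity) two_pos hd₁ hd₁₂
    (fun t ht x y => heatG_bdryPoint_nonneg ht x y)
    (fun t ht x y => (heatG_bdryPoint_le ht x y).trans_eq (by congr 3; ring))
    (fun t ht x => lintegral_heatG_bdryPoint_right_le ht x)
    (fun t ht y => lintegral_heatG_bdryPoint_left_le ht y _)
  obtain ⟨C₃, hC₃, H₃⟩ := exists_lintegral_lorentzNorm_le
    (μ := (volume : Measure (EuclideanSpace ℝ (Fin (m + 1)))).restrict (upperHalf m))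
    (ν := (volume : Measure (EuclideanSpace ℝ (Fin m))))
    (K := fun t y x => heatG x (bdryPoint y) t)
    (a := 1 / 2) (b := 0) (κ := ((m : ℝ) + 1) / 2) (c := 2)
    (measurable_heatG_bdryPoint.comp
      (show Measurable fun z : (ℝ × EuclideanSpace ℝ (Fin m)) × EuclideanSpace ℝ (Fin (m + 1)) =>
        ((z.1.1, z.2), z.1.2) by fun_prop))
    (by positivity) two_pos hd₁ hd₁₂
    (fun t ht y x => heatG_bdryPoint_nonneg ht x y)
    (fun t ht y x => (heatG_bdryPoint_le ht x y).trans_eq (by congr 3; ring))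
    (fun t ht y => lintegral_heatG_bdryPoint_left_le ht y _)
    (fun t ht x => lintegral_heatG_bdryPoint_right_le ht x)
  have hle₁ : ENNReal.ofReal C₁ ≤ ENNReal.ofReal (C₁ + C₂ + C₃) :=
    ENNReal.ofReal_le_ofReal (by linarith)
  have hle₂ : ENNReal.ofReal C₂ ≤ ENNReal.ofReal (C₁ + C₂ + C₃) :=
    ENNReal.ofReal_le_ofReal (by linarith)
  have hle₃ : ENNReal.ofReal C₃ ≤ ENNReal.ofReal (C₁ + C₂ + C₃) :=
    ENNReal.ofReal_le_ofReal (by linarith)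
  refine ⟨C₁ + C₂ + C₃, by positivity, fun ψ hψ => ?_, fun φ hφ => ?_⟩
  · obtain ⟨-, m₁, n₁, e₁⟩ := H₁ ψ hψ
    obtain ⟨i₂, m₂, n₂, e₂⟩ := H₂ ψ hψ
    refine ⟨fun t ht => ⟨i₂ t ht, (m₁ t).aemeasurable, (m₂ t).aemeasurable⟩,
      n₁.aemeasurable, ?_, n₂.aemeasurable, ?_⟩
    · refine le_trans (le_of_eq ?_) (e₁.trans (mul_le_mul_left hle₁ _))
      refine lintegral_congr fun t => ?_
      congr 3
      push_cast
      field_simp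
      ring
    · refine le_trans (le_of_eq ?_) (e₂.trans (mul_le_mul_left hle₂ _))
      refine lintegral_congr fun t => ?_
      congr 3
      push_cast
      field_simp
      ring
  · obtain ⟨i₃, m₃, n₃, e₃⟩ := H₃ φ hφ
    refine ⟨fun t ht => ⟨i₃ t ht, (m₃ t).aemeasurable⟩, n₃.aemeasurable, ?_⟩
    refine le_trans (le_of_eq ?_) (e₃.trans (mul_le_mul_left hle₃ _))
    refine lintegral_congr fun t => ?_
    congr 3
    push_cast
    field_simp
    ring
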